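/- For each integer $n\ge 1$ let $Z^{(n)}_1,Z^{(n)}_2,\dots$ be independent random variables (on a probability space which may depend on $n$), each uniformly distributed over $N_n=\{1,\dots,n\}$. Let $a_n\in N_n$ for all $n\ge1$, put $b_n=n-a_n$, and let $$S_{n,a_n}=\min\bigl\{k:\ \#\{j\in N_n:\ Z^{(n)}_{i-1}=Z^{(n)}_i=j\ \text{for some } 2\le i\le k\}\ge a_n\bigr\}$$ be the waiting time until $a_n$ distinct pairs $jj$, $j\in N_n$, have occurred as runs of two consecutive draws. Let $\Phi$ be the standard normal distribution function. Then $S_{n,a_n}$ is almost surely finite for every $n\ge1$, and the following hold. (a) If $a_n\to\infty$ and $a_n/n\to0$ as $n\to\infty$, then for every real $x$ $$\lim_{n\to\infty}P\left\{\frac{S_{n,a_n}+n^2\ln(1-a_n/n)}{n\,a_n^{1/2}}\le x\right\}=\Phi(x).$$ (b) If $a_n/n\to\lambda\in(0,1)$ as $n\to\infty$ and $\lambda_0=\lambda/(1-\lambda)$, then for every real $x$ $$\lim_{n\to\infty}P\left\{\frac{S_{n,a_n}+n^2\ln(1-a_n/n)}{\lambda_0^{1/2}\,n^{3/2}}\le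 x\right\}=\Phi(x).$$ (c) If $a_n/n\to1$ and $b_n\to\infty$ as $n\to\infty$, then for every real $x$ $$\lim_{n\to\infty}P\left\{\frac{S_{n,a_n}+n^2\ln(1-a_n/n)}{n^2\,b_n^{-1/2}}\le x\right\}=\Phi(x).$$ -/

import Mathlib

open MeasureTheory ProbabilityTheory Filter Topology
open scoped ENNReal

/-- `Z 0, Z 1, Z 2, …` are draws with replacement from `{1, …, n}`: independent random variables,
each of them uniformly distributed over `{1, …, n}`. Here `Z i` is the draw number `i + 1`.
(For a probability measure `P` the last field forces `Z i ∈ {1, …, n}` almost surely.) -/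
structure IsUniformSampling (n : ℕ) {Ω : Type*} [MeasurableSpace Ω] (P : Measure Ω)
    (Z : ℕ → Ω → ℕ) : Prop where
  measurable : ∀ i, Measurable (Z i)
  indep : iIndepFun Z P
  uniform : ∀ i, ∀ j ∈ Finset.Icc 1 n, P (Z i ⁻¹' {j}) = (n : ℝ≥0∞)⁻¹

/-- The set of those `j ∈ {1, …, n}` for which the pair `jj` occurs as a run of two consecutive
draws among the first `k` draws `z 0, …, z (k - 1)`. -/
def sampledPairs (n : ℕ) (z : ℕ → ℕ) (k : ℕ) : Finset ℕ :=
  (Finset.Icc 1 n).filter fun j => ∃ i < k - 1, z i = j ∧ z (i + 1) = j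

/-- The waiting time until `a` distinct pairs `jj`, `j ∈ {1, …, n}`, are sampled: the least number
`k` of draws such that `a` different pairs have occurred among the first `k` draws.
(If there is no such `k`, the value is `0`.) -/
noncomputable def waitingTime (n a : ℕ) (z : ℕ → ℕ) : ℕ :=
  sInf {k : ℕ | a ≤ (sampledPairs n z k).card}

/-- The standard normal distribution function `Φ`. -/
noncomputable def stdNormalCDF (x : ℝ) : ℝ := cdf (gaussianReal 0 1) x

/-! The progress of the sampling is a Markov chain with two coordinates: the number m of pairs
found, and whether the last draw is fresh, that is, one draw away from a new pair. For a parameter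
y, `stateWeight` is a function of this state whose mean after one draw is y times its present value
(`sum_stateWeight_update`). Hence y⁻¹ ^ k times the weight, stopped at the waiting time S, has mean
1 for every k.

For a real y slightly below 1 this mean, with Markov's inequality, forces S to be finite almost
surely. For y = s⁻¹ on the unit circle, letting k → ∞ gives E[s ^ S] · `pairProd n s⁻¹ a` = 1, an
exact product formula for the characteristic function.

With s = exp(iθ) the factors of the product are 1 + v/(n - i), where v = n(y - 1)(ny + 1) ≈ -iθn².
The logarithm is v ∑ 1/(n - i) - (v²/2) ∑ 1/(n - i)² up to a cubic error. The first sum is close to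
-log(1 - a/n), which gives the centring; the second is close to 1/(n - a) - 1/n = a/(n(n - a)),
which gives the variance n³a/(n - a). So the reciprocal characteristic function of the normalised
time tends to exp(t²/2), and Lévy's continuity theorem applies. The three regimes differ only in the
equivalent chosen for the variance. -/

/-- After `k` draws, the last draw is a letter of `{1, …, n}` whose pair has not been sampled. -/
def LastFresh (n : ℕ) (z : ℕ → ℕ) (k : ℕ) : Prop :=
  0 < k ∧ z (k - 1) ∈ Finset.Icc 1 n ∧ z (k - 1) ∉ sampledPairs n z k

/-! ### Combinatorics of sampled pairs under one more draw. -/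

lemma mem_sampledPairs {n : ℕ} {z : ℕ → ℕ} {k j : ℕ} :
    j ∈ sampledPairs n z k ↔ j ∈ Finset.Icc 1 n ∧ ∃ i < k - 1, z i = j ∧ z (i + 1) = j := by
  simp [sampledPairs]

lemma sampledPairs_subset (n : ℕ) (z : ℕ → ℕ) (k : ℕ) :
    sampledPairs n z k ⊆ Finset.Icc 1 n := Finset.filter_subset _ _

lemma card_sampledPairs_le (n : ℕ) (z : ℕ → ℕ) (k : ℕ) : (sampledPairs n z k).card ≤ n := by
  simpa using Finset.card_le_card (sampledPairs_subset n z k)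

lemma sampledPairs_mono (n : ℕ) (z : ℕ → ℕ) : Monotone (sampledPairs n z) := by
  intro k k' h j
  simp only [mem_sampledPairs]
  rintro ⟨h1, i, hi, h2⟩
  exact ⟨h1, i, by omega, h2⟩

lemma sampledPairs_congr (n : ℕ) {z z' : ℕ → ℕ} {k : ℕ} (h : ∀ i < k, z i = z' i) :
    sampledPairs n z k = sampledPairs n z' k := by
  ext j
  simp only [mem_sampledPairs]
  refine and_congr_right fun _ => exists_congr fun i => and_congr_right fun hi => ?_
  rw [h i (by omega), h (i + 1) (by omega)]

lemma lastFresh_congr (n : ℕ) {z z' : ℕ → ℕ} {k : ℕ} (h : ∀ i < k, z i = z' i) :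
    LastFresh n z k ↔ LastFresh n z' k := by
  unfold LastFresh
  rw [sampledPairs_congr n h]
  refine and_congr_right fun hk => ?_
  rw [h (k - 1) (by omega)]

@[simp] lemma sampledPairs_zero (n : ℕ) (z : ℕ → ℕ) : sampledPairs n z 0 = ∅ := by
  ext j; simp [mem_sampledPairs]

lemma sampledPairs_succ_of_eq {n : ℕ} {z : ℕ → ℕ} {k : ℕ} (hf : LastFresh n z k)
    (h : z k = z (k - 1)) : sampledPairs n z (k + 1) = insert (z k) (sampledPairs n z k) := by
  obtain ⟨hk, hm, -⟩ := hf
  ext j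
  simp only [mem_sampledPairs, Finset.mem_insert]
  constructor
  · rintro ⟨h1, i, hi, h2, h3⟩
    by_cases hik : i < k - 1
    · exact Or.inr ⟨h1, i, hik, h2, h3⟩
    · have : i = k - 1 := by omega
      subst this
      left; rw [h, h2]
  · rintro (rfl | ⟨h1, i, hi, h2⟩)
    · refine ⟨h ▸ hm, k - 1, by omega, h.symm, ?_⟩
      rw [Nat.sub_add_cancel hk]
    · exact ⟨h1, i, by omega, h2⟩

lemma sampledPairs_succ_of_not {n : ℕ} {z : ℕ → ℕ} {k : ℕ}
    (h : ¬ (LastFresh n z k ∧ z k = z (k - 1))) :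
    sampledPairs n z (k + 1) = sampledPairs n z k := by
  refine Finset.Subset.antisymm (fun j hj => ?_) (sampledPairs_mono n z (Nat.le_succ k))
  by_contra hj'
  obtain ⟨h1, i, hi, h2, h3⟩ := mem_sampledPairs.1 hj
  have hik : ¬ i < k - 1 := fun hik => hj' (mem_sampledPairs.2 ⟨h1, i, hik, h2, h3⟩)
  have : i = k - 1 := by omega
  subst this
  rw [Nat.sub_add_cancel (by omega)] at h3
  subst h2
  exact h ⟨⟨by omega, h1, hj'⟩, h3⟩

/-- The draw that completes a pair is no longer fresh; therefore the state at the waiting time is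
determined by `a` alone. -/
lemma not_lastFresh_succ_of_eq {n : ℕ} {z : ℕ → ℕ} {k : ℕ} (hf : LastFresh n z k)
    (h : z k = z (k - 1)) : ¬ LastFresh n z (k + 1) := by
  rintro ⟨-, -, h3⟩
  rw [sampledPairs_succ_of_eq hf h] at h3
  simp at h3

lemma card_succ_of_eq {n : ℕ} {z : ℕ → ℕ} {k : ℕ} (hf : LastFresh n z k)
    (h : z k = z (k - 1)) :
    (sampledPairs n z (k + 1)).card = (sampledPairs n z k).card + 1 := by
  rw [sampledPairs_succ_of_eq hf h, Finset.card_insert_of_notMem]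
  rw [h]; exact hf.2.2

lemma waitingTime_le {n a : ℕ} {z : ℕ → ℕ} {k : ℕ} (h : a ≤ (sampledPairs n z k).card) :
    waitingTime n a z ≤ k := Nat.sInf_le h

lemma waitingTime_congr {n a : ℕ} {z z' : ℕ → ℕ} {k : ℕ} (h : ∀ i < k, z i = z' i)
    (hk : a ≤ (sampledPairs n z k).card) : waitingTime n a z = waitingTime n a z' := by
  have key : ∀ {w w' : ℕ → ℕ}, (∀ i < k, w i = w' i) → a ≤ (sampledPairs n w k).card →
      waitingTime n a w' ≤ waitingTime n a w := by
    intro w w' hw hwk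
    have hle := waitingTime_le hwk
    have hmem : waitingTime n a w ∈ {k : ℕ | a ≤ (sampledPairs n w k).card} :=
      Nat.sInf_mem ⟨k, hwk⟩
    refine waitingTime_le ?_
    rw [← sampledPairs_congr n (fun i hi => hw i (lt_of_lt_of_le hi hle))]
    exact hmem
  exact le_antisymm (key (fun i hi => (h i hi).symm) (sampledPairs_congr n h ▸ hk)) (key h hk)

lemma waitingTime_eq_succ {n a : ℕ} {z : ℕ → ℕ} {k : ℕ} (h : (sampledPairs n z k).card < a)
    (h' : a ≤ (sampledPairs n z (k + 1)).card) : waitingTime n a z = k + 1 := by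
  refine le_antisymm (waitingTime_le h') ?_
  by_contra hlt
  have hmem : waitingTime n a z ∈ {k : ℕ | a ≤ (sampledPairs n z k).card} :=
    Nat.sInf_mem ⟨k + 1, h'⟩
  have := Finset.card_le_card (sampledPairs_mono n z (show waitingTime n a z ≤ k by omega))
  simp only [Set.mem_ofPred_eq] at hmem
  omega

/-! ### The harmonic weight and its one-step mean. -/

section Weight

variable {𝕜 : Type*} [Field 𝕜]

/-- The reciprocal of the generating function, at `y⁻¹`, of the time to sample `m` pairs. -/
def pairProd (n : ℕ) (y : 𝕜) (m : ℕ) : 𝕜 :=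
  ∏ i ∈ Finset.range m, (1 + n * (y - 1) * (n * y + 1) / ((n : 𝕜) - i))

open Classical in
/-- The harmonic weight of the state reached after `k` draws. -/
noncomputable def stateWeight (n : ℕ) (y : 𝕜) (z : ℕ → ℕ) (k : ℕ) : 𝕜 :=
  pairProd n y (sampledPairs n z k).card *
    if LastFresh n z k then 1 + n * (y - 1) / ((n : 𝕜) - (sampledPairs n z k).card) else 1

/-- The weight discounted by `y⁻¹` per draw, stopped at the waiting time. -/
noncomputable def stoppedWeight (n a : ℕ) (y : 𝕜) (z : ℕ → ℕ) (k : ℕ) : 𝕜 :=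
  if (sampledPairs n z k).card < a then y⁻¹ ^ k * stateWeight n y z k
  else y⁻¹ ^ waitingTime n a z * pairProd n y a

lemma stateWeight_congr (n : ℕ) (y : 𝕜) {z z' : ℕ → ℕ} {k : ℕ} (h : ∀ i < k, z i = z' i) :
    stateWeight n y z k = stateWeight n y z' k := by
  unfold stateWeight
  rw [sampledPairs_congr n h]
  by_cases hf : LastFresh n z k
  · rw [if_pos hf, if_pos ((lastFresh_congr n h).1 hf)]
  · rw [if_neg hf, if_neg (fun h' => hf ((lastFresh_congr n h).2 h'))]

lemma stoppedWeight_congr (n a : ℕ) (y : 𝕜) {z z' : ℕ → ℕ} {k : ℕ} (h : ∀ i < k, z i = z' i) :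
    stoppedWeight n a y z k = stoppedWeight n a y z' k := by
  unfold stoppedWeight
  rw [stateWeight_congr n y h, ← sampledPairs_congr n h]
  split_ifs with hc
  · rfl
  · rw [waitingTime_congr h (not_lt.1 hc)]

lemma stoppedWeight_zero (n a : ℕ) (ha : 1 ≤ a) (y : 𝕜) (z : ℕ → ℕ) :
    stoppedWeight n a y z 0 = 1 := by
  have : ¬ LastFresh n z 0 := fun h => absurd h.1 (lt_irrefl 0)
  simp [stoppedWeight, stateWeight, pairProd, this, show 0 < a from ha]

/-- If this draw reaches the target, the count is exactly `a` and the last draw is not fresh, so the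
stopped and unstopped formulas agree. -/
lemma stoppedWeight_succ_of_lt {n a : ℕ} (y : 𝕜) {z : ℕ → ℕ} {k : ℕ}
    (h : (sampledPairs n z k).card < a) :
    stoppedWeight n a y z (k + 1) = y⁻¹ ^ (k + 1) * stateWeight n y z (k + 1) := by
  unfold stoppedWeight
  split_ifs with hc
  · rfl
  · have hc' := not_lt.1 hc
    by_cases hh : LastFresh n z k ∧ z k = z (k - 1)
    · have h1 := card_succ_of_eq hh.1 hh.2
      have h2 : (sampledPairs n z (k + 1)).card = a := by omega
      rw [waitingTime_eq_succ h hc', stateWeight, h2, if_neg (not_lastFresh_succ_of_eq hh.1 hh.2),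
        mul_one]
    · rw [sampledPairs_succ_of_not hh] at hc'
      omega

lemma stoppedWeight_succ_of_le {n a : ℕ} (y : 𝕜) {z : ℕ → ℕ} {k : ℕ}
    (h : a ≤ (sampledPairs n z k).card) :
    stoppedWeight n a y z (k + 1) = stoppedWeight n a y z k := by
  have := Finset.card_le_card (sampledPairs_mono n z (show k ≤ k + 1 by omega))
  unfold stoppedWeight
  rw [if_neg (by omega), if_neg (by omega)]

lemma stateWeight_succ_of_eq {n : ℕ} (y : 𝕜) {z : ℕ → ℕ} {k : ℕ} (hf : LastFresh n z k)
    (h : z k = z (k - 1)) :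
    stateWeight n y z (k + 1) = pairProd n y (sampledPairs n z k).card *
      (1 + n * (y - 1) * (n * y + 1) / ((n : 𝕜) - (sampledPairs n z k).card)) := by
  rw [stateWeight, if_neg (not_lastFresh_succ_of_eq hf h), card_succ_of_eq hf h, pairProd,
    Finset.prod_range_succ, mul_one, pairProd]

lemma stateWeight_succ_of_mem {n : ℕ} (y : 𝕜) {z : ℕ → ℕ} {k : ℕ}
    (h : z k ∈ sampledPairs n z k) :
    stateWeight n y z (k + 1) = pairProd n y (sampledPairs n z k).card := by
  have h0 : sampledPairs n z (k + 1) = sampledPairs n z k := by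
    refine sampledPairs_succ_of_not fun hh => hh.1.2.2 ?_
    rw [← hh.2]; exact h
  have h1 : ¬ LastFresh n z (k + 1) := fun hh => hh.2.2 (by simpa [h0] using h)
  rw [stateWeight, if_neg h1, mul_one, h0]

lemma stateWeight_succ_of_notMem {n : ℕ} (y : 𝕜) {z : ℕ → ℕ} {k : ℕ}
    (hz : z k ∈ Finset.Icc 1 n) (h : z k ∉ sampledPairs n z k)
    (hh : ¬ (LastFresh n z k ∧ z k = z (k - 1))) :
    stateWeight n y z (k + 1) = pairProd n y (sampledPairs n z k).card *
      (1 + n * (y - 1) / ((n : 𝕜) - (sampledPairs n z k).card)) := by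
  have h0 : sampledPairs n z (k + 1) = sampledPairs n z k := sampledPairs_succ_of_not hh
  have h1 : LastFresh n z (k + 1) := ⟨k.succ_pos, by simpa using hz, by simpa [h0] using h⟩
  rw [stateWeight, if_pos h1, h0]

/-- Let Φ be the product for m pairs. If the last draw is not fresh, m letters give Φ and n - m give
Φ(1 + n(y - 1)/(n - m)), in total nyΦ. If it is fresh, one of the latter terms is replaced by the
product for m + 1 pairs; the factor of `pairProd` is the one that makes the balance hold. -/
lemma sum_stateWeight_update [CharZero 𝕜] {n : ℕ} (y : 𝕜) (z : ℕ → ℕ) (k : ℕ)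
    (h : (sampledPairs n z k).card < n) :
    ∑ j ∈ Finset.Icc 1 n, stateWeight n y (Function.update z k j) (k + 1)
      = n * y * stateWeight n y z k := by
  set A := sampledPairs n z k with hA
  set Φ := pairProd n y A.card with hΦ
  have hl : ((n : 𝕜) - A.card) ≠ 0 := by
    rw [sub_ne_zero]; exact_mod_cast h.ne'
  have hup : ∀ j, ∀ i < k, z i = Function.update z k j i := fun j i hi => by
    rw [Function.update_of_ne hi.ne]
  have hAj : ∀ j, sampledPairs n (Function.update z k j) k = A := fun j =>
    (sampledPairs_congr n (hup j)).symm
  have hFj : ∀ j, LastFresh n (Function.update z k j) k ↔ LastFresh n z k := fun j =>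
    (lastFresh_congr n (hup j)).symm
  have hlast : ∀ j, LastFresh n z k → Function.update z k j (k - 1) = z (k - 1) := fun j hf =>
    (hup j (k - 1) (Nat.sub_lt hf.1 one_pos)).symm
  have hAs : A ⊆ Finset.Icc 1 n := sampledPairs_subset n z k
  have hmem : ∀ j ∈ A, stateWeight n y (Function.update z k j) (k + 1) = Φ := by
    intro j hj
    rw [stateWeight_succ_of_mem y (by rw [hAj]; simpa using hj), hAj]
  have hnot : ∀ j ∈ Finset.Icc 1 n \ A, ¬ (LastFresh n z k ∧ j = z (k - 1)) →
      stateWeight n y (Function.update z k j) (k + 1)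
        = Φ * (1 + n * (y - 1) / ((n : 𝕜) - A.card)) := by
    intro j hj hjn
    rw [Finset.mem_sdiff] at hj
    rw [stateWeight_succ_of_notMem y (by simpa using hj.1) (by rw [hAj]; simpa using hj.2), hAj]
    rintro ⟨h1, h2⟩
    rw [hFj] at h1
    rw [hlast j h1, Function.update_self] at h2
    exact hjn ⟨h1, h2⟩
  have hcard : (Finset.Icc 1 n \ A).card = n - A.card := by
    rw [Finset.card_sdiff_of_subset hAs]; simp
  rw [← Finset.sum_sdiff hAs, Finset.sum_congr rfl hmem, Finset.sum_const, nsmul_eq_mul]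
  by_cases hf : LastFresh n z k
  · have hu : z (k - 1) ∈ Finset.Icc 1 n \ A := Finset.mem_sdiff.2 ⟨hf.2.1, hf.2.2⟩
    rw [← Finset.add_sum_erase _ _ hu, Finset.sum_congr rfl (fun j hj =>
      hnot j (Finset.mem_of_mem_erase hj) (fun hh => Finset.ne_of_mem_erase hj hh.2)),
      Finset.sum_const, Finset.card_erase_of_mem hu, hcard, nsmul_eq_mul,
      stateWeight_succ_of_eq y ((hFj _).2 hf) (by rw [hlast _ hf]; simp), hAj, stateWeight,
      if_pos hf, ← hA, ← hΦ, Nat.cast_sub (by omega), Nat.cast_sub h.le]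
    field_simp
    push_cast
    ring
  · rw [Finset.sum_congr rfl (fun j hj => hnot j hj (fun hh => hf hh.1)), Finset.sum_const, hcard,
      nsmul_eq_mul, stateWeight, if_neg hf, ← hA, ← hΦ, Nat.cast_sub h.le]
    field_simp
    ring

/-- One step of the martingale property of the stopped weight. -/
lemma sum_stoppedWeight_update [CharZero 𝕜] {n a : ℕ} (han : a ≤ n) {y : 𝕜} (hy : y ≠ 0)
    (z : ℕ → ℕ) (k : ℕ) :
    ∑ j ∈ Finset.Icc 1 n, stoppedWeight n a y (Function.update z k j) (k + 1)
      = n * stoppedWeight n a y z k := by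
  have hup : ∀ j, ∀ i < k, z i = Function.update z k j i := fun j i hi => by
    rw [Function.update_of_ne hi.ne]
  by_cases h : (sampledPairs n z k).card < a
  · rw [Finset.sum_congr rfl fun j _ => stoppedWeight_succ_of_lt y
      ((sampledPairs_congr n (hup j)) ▸ h), ← Finset.mul_sum,
      sum_stateWeight_update y z k (h.trans_le han), stoppedWeight, if_pos h, pow_succ]
    field_simp
  · rw [Finset.sum_congr rfl fun j _ => stoppedWeight_succ_of_le y
      ((sampledPairs_congr n (hup j)) ▸ (not_lt.1 h)),
      Finset.sum_congr rfl fun j _ => (stoppedWeight_congr n a y (hup j)).symm]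
    simp

end Weight

/-! ### The stopped martingale, almost sure finiteness and the generating function. -/

section Sampling

variable {Ω : Type*} [MeasurableSpace Ω] {P : Measure Ω} {n : ℕ} {Z : ℕ → Ω → ℕ}

/-- The n prescribed masses already add up to 1, so nothing is left outside {1, …, n}. -/
lemma IsUniformSampling.map_eq [IsProbabilityMeasure P] (hZ : IsUniformSampling n P Z)
    (hn : 1 ≤ n) (k : ℕ) :
    P.map (Z k) = ∑ j ∈ Finset.Icc 1 n, (n : ℝ≥0∞)⁻¹ • Measure.dirac j := by
  have hprob : IsProbabilityMeasure (P.map (Z k)) :=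
    Measure.isProbabilityMeasure_map (hZ.measurable k).aemeasurable
  have hsing : ∀ j ∈ Finset.Icc 1 n, P.map (Z k) {j} = (n : ℝ≥0∞)⁻¹ := fun j hj => by
    rw [Measure.map_apply (hZ.measurable k) (measurableSet_singleton j), hZ.uniform k j hj]
  have hIcc : P.map (Z k) (Finset.Icc 1 n : Finset ℕ) = 1 := by
    rw [← sum_measure_singleton, Finset.sum_congr rfl hsing]
    simp only [Finset.sum_const, Nat.card_Icc, Nat.add_sub_cancel, nsmul_eq_mul]
    exact ENNReal.mul_inv_cancel (by exact_mod_cast (by omega : n ≠ 0)) (by simp)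
  refine Measure.ext_of_singleton fun j => ?_
  by_cases hj : j ∈ Finset.Icc 1 n
  · rw [hsing j hj, Measure.finsetSum_apply, Finset.sum_eq_single j]
    · simp
    · intro i _ hij; simp [hij]
    · exact fun h => absurd hj h
  · have h0 : P.map (Z k) ((Finset.Icc 1 n : Finset ℕ) : Set ℕ)ᶜ = 0 := by
      rw [prob_compl_eq_zero_iff (Finset.measurableSet _), hIcc]
    rw [measure_mono_null (by simpa using hj) h0, Measure.finsetSum_apply]
    symm
    refine Finset.sum_eq_zero fun i hi => ?_
    have : i ≠ j := fun h => hj (h ▸ hi)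
    simp [this]

lemma IsUniformSampling.measurable_of_congr {β : Type*} [MeasurableSpace β]
    (hZ : IsUniformSampling n P Z) {F : (ℕ → ℕ) → β} {k : ℕ}
    (hF : ∀ z z' : ℕ → ℕ, (∀ i < k, z i = z' i) → F z = F z') :
    Measurable fun ω => F fun i => Z i ω := by
  let X : Ω → (Finset.range k → ℕ) := fun ω i => Z i ω
  have hX : Measurable X := measurable_pi_lambda _ fun i => hZ.measurable i
  let G : (Finset.range k → ℕ) → β := fun x =>
    F fun i => if h : i ∈ Finset.range k then x ⟨i, h⟩ else 0
  have hG : Measurable G := Measurable.of_discrete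
  have : (fun ω => F fun i => Z i ω) = G ∘ X := by
    funext ω
    refine hF _ _ fun i hi => ?_
    simp [X, hi]
  rw [this]
  exact hG.comp hX

/-- Averaging over the last of the draws that a function depends on. -/
lemma IsUniformSampling.integral_update [IsProbabilityMeasure P] {𝕜 : Type*} [RCLike 𝕜]
    (hZ : IsUniformSampling n P Z) (hn : 1 ≤ n) {F : (ℕ → ℕ) → 𝕜} {k : ℕ}
    (hF : ∀ z z' : ℕ → ℕ, (∀ i < k + 1, z i = z' i) → F z = F z') {C : ℝ}
    (hC : ∀ z, ‖F z‖ ≤ C) :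
    ∫ ω, F (fun i => Z i ω) ∂P
      = ∫ ω, (n : 𝕜)⁻¹ * ∑ j ∈ Finset.Icc 1 n, F (Function.update (fun i => Z i ω) k j) ∂P := by
  let X : Ω → (Finset.range k → ℕ) := fun ω i => Z i ω
  have hX : Measurable X := measurable_pi_lambda _ fun i => hZ.measurable i
  -- Indices beyond `k` also receive the last draw; this is harmless because `F` does not read them.
  let G : (Finset.range k → ℕ) × ℕ → 𝕜 := fun p =>
    F fun i => if h : i ∈ Finset.range k then p.1 ⟨i, h⟩ else p.2
  have hGm : Measurable G := Measurable.of_discrete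
  have hFG : ∀ ω j, F (Function.update (fun i => Z i ω) k j) = G (X ω, j) := by
    intro ω j
    refine hF _ _ fun i hi => ?_
    rcases Nat.lt_succ_iff_lt_or_eq.1 hi with hi | rfl
    · simp [X, hi, hi.ne]
    · simp
  have hFG' : ∀ ω, F (fun i => Z i ω) = G (X ω, Z k ω) := by
    intro ω
    rw [← hFG, Function.update_eq_self_iff.2 rfl]
  have hind : IndepFun X (Z k) P := by
    have := hZ.indep.indepFun_finset (Finset.range k) {k} (by simp) hZ.measurable
    exact this.comp (φ := id) (ψ := fun x : ({k} : Finset ℕ) → ℕ => x ⟨k, by simp⟩)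
      measurable_id (measurable_pi_apply _)
  have hprob : IsProbabilityMeasure (P.map X) := Measure.isProbabilityMeasure_map hX.aemeasurable
  have hprob' : IsProbabilityMeasure (P.map (Z k)) :=
    Measure.isProbabilityMeasure_map (hZ.measurable k).aemeasurable
  have hGint : Integrable G ((P.map X).prod (P.map (Z k))) :=
    Integrable.of_bound hGm.aestronglyMeasurable C (ae_of_all _ fun p => hC _)
  simp_rw [hFG, hFG']
  calc ∫ ω, G (X ω, Z k ω) ∂P
      = ∫ p, G p ∂(P.map fun ω => (X ω, Z k ω)) :=
        (integral_map (hX.prodMk (hZ.measurable k)).aemeasurable hGm.aestronglyMeasurable).symm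
    _ = ∫ x, ∫ j, G (x, j) ∂(P.map (Z k)) ∂(P.map X) := by
        rw [hind.map_prod_eq_prod_map_map hX.aemeasurable (hZ.measurable k).aemeasurable,
          integral_prod _ hGint]
    _ = ∫ x, (n : 𝕜)⁻¹ * ∑ j ∈ Finset.Icc 1 n, G (x, j) ∂(P.map X) := by
        refine integral_congr_ae (ae_of_all _ fun x => ?_)
        have hi : ∀ j ∈ Finset.Icc 1 n, Integrable (fun j => G (x, j))
            ((n : ℝ≥0∞)⁻¹ • Measure.dirac j) := fun j _ => by
          refine Integrable.smul_measure ?_ (by simp; omega)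
          exact Integrable.of_bound Measurable.of_discrete.aestronglyMeasurable C
            (ae_of_all _ fun p => hC _)
        simp only
        rw [hZ.map_eq hn, integral_finsetSum_measure hi, Finset.mul_sum]
        refine Finset.sum_congr rfl fun j _ => ?_
        rw [integral_smul_measure, integral_dirac, RCLike.real_smul_eq_coe_mul]
        simp
    _ = _ := integral_map hX.aemeasurable Measurable.of_discrete.aestronglyMeasurable

/-- Only finitely many states exist: at most n pairs, fresh or not. -/
lemma exists_norm_stateWeight_le {𝕜 : Type*} [RCLike 𝕜] (n : ℕ) (y : 𝕜) :
    ∃ C, ∀ z k, ‖stateWeight n y z k‖ ≤ C := by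
  refine ⟨∑ m ∈ Finset.range (n + 1),
    (‖pairProd n y m * (1 + n * (y - 1) / ((n : 𝕜) - m))‖ + ‖pairProd n y m * 1‖),
    fun z k => ?_⟩
  refine le_trans ?_ (Finset.single_le_sum (fun m _ => by positivity)
    (Finset.mem_range.2 (Nat.lt_succ_of_le (card_sampledPairs_le n z k))))
  unfold stateWeight
  split_ifs
  · exact le_add_of_nonneg_right (norm_nonneg _)
  · exact le_add_of_nonneg_left (norm_nonneg _)

lemma exists_norm_stoppedWeight_le {𝕜 : Type*} [RCLike 𝕜] (n a : ℕ) (y : 𝕜) :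
    ∃ C, ∀ z k, ‖stoppedWeight n a y z k‖ ≤ max 1 ‖y⁻¹‖ ^ k * C := by
  obtain ⟨C, hC⟩ := exists_norm_stateWeight_le n y
  refine ⟨max C ‖pairProd n y a‖, fun z k => ?_⟩
  unfold stoppedWeight
  split_ifs with h
  · rw [norm_mul, norm_pow]
    exact mul_le_mul (pow_le_pow_left₀ (norm_nonneg _) (le_max_right _ _) _)
      ((hC z k).trans (le_max_left _ _)) (norm_nonneg _) (by positivity)
  · rw [norm_mul, norm_pow]
    refine mul_le_mul ?_ (le_max_right _ _) (norm_nonneg _) (by positivity)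
    exact (pow_le_pow_left₀ (norm_nonneg _) (le_max_right 1 _) _).trans
      (pow_le_pow_right₀ (le_max_left _ _) (waitingTime_le (not_lt.1 h)))

lemma IsUniformSampling.measurable_stoppedWeight {𝕜 : Type*} [RCLike 𝕜]
    (hZ : IsUniformSampling n P Z) (a : ℕ) (y : 𝕜) (k : ℕ) :
    Measurable fun ω => stoppedWeight n a y (fun i => Z i ω) k :=
  hZ.measurable_of_congr (F := fun z => stoppedWeight n a y z k)
    fun _ _ h => stoppedWeight_congr n a y h

lemma IsUniformSampling.integral_stoppedWeight [IsProbabilityMeasure P] {𝕜 : Type*} [RCLike 𝕜]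
    (hZ : IsUniformSampling n P Z) {a : ℕ} (ha : 1 ≤ a) (han : a ≤ n) {y : 𝕜} (hy : y ≠ 0)
    (k : ℕ) : ∫ ω, stoppedWeight n a y (fun i => Z i ω) k ∂P = 1 := by
  obtain ⟨C, hC⟩ := exists_norm_stoppedWeight_le n a y
  induction k with
  | zero => simp [stoppedWeight_zero n a ha]
  | succ k ih =>
    rw [hZ.integral_update (ha.trans han) (F := fun z => stoppedWeight n a y z (k + 1))
      (fun _ _ h => stoppedWeight_congr n a y h) (fun z => hC z (k + 1)), ← ih]
    refine integral_congr_ae (ae_of_all _ fun ω => ?_)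
    simp only
    rw [sum_stoppedWeight_update han hy, inv_mul_cancel_left₀]
    exact_mod_cast (by omega : n ≠ 0)

/-- The waiting time for `a ≤ n` distinct pairs is almost surely finite. -/
lemma IsUniformSampling.ae_exists_le_card [IsProbabilityMeasure P]
    (hZ : IsUniformSampling n P Z) {a : ℕ} (ha : 1 ≤ a) (han : a ≤ n) :
    ∀ᵐ ω ∂P, ∃ k, a ≤ (sampledPairs n (fun i => Z i ω) k).card := by
  have hn : (1 : ℝ) ≤ n := by exact_mod_cast ha.trans han
  -- Chosen so that n · ε · (n + 1) = 1/2: since n - m ≥ 1, every factor of the weight is then at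
  -- least 1/2.
  set ε : ℝ := 1 / (2 * n * (n + 1)) with hε
  have hε0 : 0 < ε := by positivity
  have hεn : n * ε * (n + 1) = 1 / 2 := by rw [hε]; field_simp
  have hε1 : ε ≤ 1 / 2 := by
    have h1 : ε ≤ n * ε := le_mul_of_one_le_left hε0.le hn
    have h2 : n * ε ≤ n * ε * (n + 1) := le_mul_of_one_le_right (by positivity) (by linarith)
    linarith
  have hεn' : n * ε ≤ 1 / 2 := by nlinarith [mul_pos (by linarith : (0 : ℝ) < n) hε0]
  set y : ℝ := 1 - ε with hy
  have hy0 : 0 < y := by linarith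
  have hfac : ∀ m < n, 1 / 2 ≤ 1 + n * (y - 1) * (n * y + 1) / ((n : ℝ) - m) ∧
      1 / 2 ≤ 1 + n * (y - 1) / ((n : ℝ) - m) := by
    intro m hm
    have hl : (1 : ℝ) ≤ n - m := by
      have : (m : ℝ) + 1 ≤ n := by exact_mod_cast hm
      linarith
    have key : ∀ x : ℝ, x ≤ 0 → -(1 / 2) ≤ x → 1 / 2 ≤ 1 + x / ((n : ℝ) - m) := by
      intro x hx hx'
      have : -(1 / 2) ≤ x / ((n : ℝ) - m) := by
        rw [le_div_iff₀ (by linarith)]; nlinarith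
      linarith
    have hye : y - 1 = -ε := by rw [hy]; ring
    have h1 : 0 ≤ n * ε := by positivity
    constructor
    · refine key _ ?_ ?_ <;> rw [hye]
      · have : 0 ≤ n * ε * (n * y + 1) := by positivity
        linarith
      · have : n * ε * (n * y + 1) ≤ n * ε * (n + 1) := by
          gcongr
          nlinarith
        linarith
    · refine key _ ?_ ?_ <;> rw [hye] <;> linarith
  have hprod : ∀ m ≤ n, (1 / 2 : ℝ) ^ n ≤ pairProd n y m := by
    intro m hm
    calc (1 / 2 : ℝ) ^ n ≤ (1 / 2) ^ m := pow_le_pow_of_le_one (by norm_num) (by norm_num) hm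
      _ = ∏ i ∈ Finset.range m, (1 / 2 : ℝ) := by simp
      _ ≤ _ := Finset.prod_le_prod (fun _ _ => by norm_num) fun i hi =>
        (hfac i ((Finset.mem_range.1 hi).trans_le hm)).1
  set c : ℝ := (1 / 2) ^ n * (1 / 2) with hc
  have hc0 : 0 < c := by positivity
  have hlow : ∀ z k, (sampledPairs n z k).card < a → y⁻¹ ^ k * c ≤ stoppedWeight n a y z k := by
    intro z k h
    rw [stoppedWeight, if_pos h, stateWeight]
    have h1 := hprod _ (h.le.trans han)
    refine mul_le_mul_of_nonneg_left (mul_le_mul h1 ?_ (by norm_num)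
      (le_trans (by positivity) h1)) (by positivity)
    · split_ifs
      · exact (hfac _ (h.trans_le han)).2
      · norm_num
  have hnonneg : ∀ z k, 0 ≤ stoppedWeight n a y z k := by
    intro z k
    by_cases h : (sampledPairs n z k).card < a
    · exact le_trans (by positivity) (hlow z k h)
    · rw [stoppedWeight, if_neg h]
      have := (pow_pos (by norm_num : (0 : ℝ) < 1 / 2) n).le.trans (hprod a han)
      positivity
  obtain ⟨C, hC⟩ := exists_norm_stoppedWeight_le n a y
  set B : Set Ω := {ω | ¬ ∃ k, a ≤ (sampledPairs n (fun i => Z i ω) k).card} with hB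
  -- Markov's inequality: the stopped weight is nonnegative with mean 1, and on `B` it is at least
  -- y⁻¹ ^ k * c, which grows since y < 1.
  have hbound : ∀ k : ℕ, P.real B ≤ y ^ k * c⁻¹ := by
    intro k
    have hint : Integrable (fun ω => stoppedWeight n a y (fun i => Z i ω) k) P :=
      Integrable.of_bound (hZ.measurable_stoppedWeight a y k).aestronglyMeasurable _
        (ae_of_all _ fun ω => hC _ k)
    have hM := mul_meas_ge_le_integral_of_nonneg (ae_of_all _ fun ω => hnonneg _ k) hint
      (y⁻¹ ^ k * c)
    rw [hZ.integral_stoppedWeight ha han hy0.ne'] at hM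
    have hsub : P.real B ≤ P.real {ω | y⁻¹ ^ k * c ≤ stoppedWeight n a y (fun i => Z i ω) k} := by
      refine measureReal_mono fun ω hω => hlow _ _ ?_
      by_contra h
      exact hω ⟨k, not_lt.1 h⟩
    have hpos : 0 < y⁻¹ ^ k * c := by positivity
    calc P.real B ≤ (y⁻¹ ^ k * c)⁻¹ := by
          rw [← one_div, le_div_iff₀ hpos, mul_comm]
          exact (mul_le_mul_of_nonneg_left hsub hpos.le).trans hM
      _ = y ^ k * c⁻¹ := by rw [mul_inv, inv_pow, inv_inv]
  have hlim : Tendsto (fun k : ℕ => y ^ k * c⁻¹) atTop (𝓝 0) := by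
    simpa using (tendsto_pow_atTop_nhds_zero_of_lt_one hy0.le (by linarith)).mul_const c⁻¹
  have h0 : P.real B ≤ 0 := ge_of_tendsto' hlim hbound
  exact (measureReal_eq_zero_iff (by finiteness)).1 (le_antisymm h0 measureReal_nonneg)

lemma IsUniformSampling.measurable_waitingTime (hZ : IsUniformSampling n P Z) (a : ℕ) :
    Measurable fun ω => waitingTime n a fun i => Z i ω := by
  have hm : ∀ k, MeasurableSet {ω | a ≤ (sampledPairs n (fun i => Z i ω) k).card} := fun k =>
    measurableSet_le measurable_const <|
      hZ.measurable_of_congr (F := fun z => (sampledPairs n z k).card)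
        fun _ _ h => by rw [sampledPairs_congr n h]
  refine measurable_of_Iic fun k => ?_
  -- The intersection accounts for the default value 0 of the waiting time when the target is never
  -- reached.
  have : (fun ω => waitingTime n a fun i => Z i ω) ⁻¹' Set.Iic k
      = {ω | a ≤ (sampledPairs n (fun i => Z i ω) k).card} ∪
        ⋂ i, {ω | a ≤ (sampledPairs n (fun i => Z i ω) i).card}ᶜ := by
    ext ω
    simp only [Set.mem_preimage, Set.mem_Iic, Set.mem_union, Set.mem_iInter, Set.mem_compl_iff,
      Set.mem_ofPred_eq]
    constructor
    · intro h
      by_contra! hh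
      obtain ⟨h1, i, h2⟩ := hh
      have hmem : waitingTime n a (fun i => Z i ω) ∈
        {k : ℕ | a ≤ (sampledPairs n (fun i => Z i ω) k).card} := Nat.sInf_mem ⟨i, h2⟩
      have := Finset.card_le_card (sampledPairs_mono n (fun i => Z i ω) h)
      simp only [Set.mem_ofPred_eq] at hmem
      omega
    · rintro (h | h)
      · exact waitingTime_le h
      · have : waitingTime n a (fun i => Z i ω) = 0 := by
          have he : {k : ℕ | a ≤ (sampledPairs n (fun i => Z i ω) k).card} = ∅ := by
            ext i; simpa using h i
          rw [waitingTime, he, Nat.sInf_empty]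
        omega
  rw [this]
  exact (hm k).union (MeasurableSet.iInter fun i => (hm i).compl)

/-- The generating function of the waiting time on the unit circle. -/
lemma IsUniformSampling.integral_pow_waitingTime [IsProbabilityMeasure P]
    (hZ : IsUniformSampling n P Z) {a : ℕ} (ha : 1 ≤ a) (han : a ≤ n) {s : ℂ} (hs : ‖s‖ = 1) :
    (∫ ω, s ^ waitingTime n a (fun i => Z i ω) ∂P) * pairProd n s⁻¹ a = 1 := by
  have hs0 : s ≠ 0 := by rintro rfl; simp at hs
  obtain ⟨C, hC⟩ := exists_norm_stoppedWeight_le n a s⁻¹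
  -- Since ‖s‖ = 1 the bound does not depend on `k`, and almost surely the stopped weight is
  -- eventually constant, so dominated convergence applies.
  have hlim : Tendsto (fun k => ∫ ω, stoppedWeight n a s⁻¹ (fun i => Z i ω) k ∂P) atTop
      (𝓝 (∫ ω, s ^ waitingTime n a (fun i => Z i ω) * pairProd n s⁻¹ a ∂P)) := by
    refine tendsto_integral_of_dominated_convergence (fun _ => C)
      (fun k => (hZ.measurable_stoppedWeight a s⁻¹ k).aestronglyMeasurable)
      (integrable_const _) (fun k => ae_of_all _ fun ω => ?_) ?_
    · simpa [hs] using hC (fun i => Z i ω) k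
    · filter_upwards [hZ.ae_exists_le_card ha han] with ω ⟨k₀, hk₀⟩
      refine tendsto_const_nhds.congr' ?_
      filter_upwards [eventually_ge_atTop k₀] with k hk
      have := Finset.card_le_card (sampledPairs_mono n (fun i => Z i ω) hk)
      rw [stoppedWeight, if_neg (by omega), inv_inv]
  simp_rw [hZ.integral_stoppedWeight ha han (inv_ne_zero hs0)] at hlim
  rw [integral_mul_const] at hlim
  exact tendsto_nhds_unique hlim tendsto_const_nhds

end Sampling

/-! ### Expansion of the product to second order. -/

/-- Comparison of a section of the harmonic series with the logarithm. -/
lemma sum_inv_sub_log_bounds (N a : ℕ) (h : a < N) :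
    ∑ i ∈ Finset.range a, (1 : ℝ) / ((N : ℝ) - i) ≤ -Real.log (1 - a / N) ∧
    -Real.log (1 - a / N) ≤ ∑ i ∈ Finset.range a, (1 : ℝ) / ((N : ℝ) - i)
      + (1 / ((N : ℝ) - a) - 1 / N) := by
  induction a with
  | zero => simp
  | succ a ih =>
    obtain ⟨h1, h2⟩ := ih (by omega)
    have hN : (0 : ℝ) < N := by exact_mod_cast (by omega : 0 < N)
    have hb : (0 : ℝ) < N - (a + 1 : ℕ) := by
      rw [sub_pos]; exact_mod_cast h
    set b : ℝ := N - (a + 1 : ℕ) with hbdef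
    have hb' : (N : ℝ) - a = b + 1 := by rw [hbdef]; push_cast; ring
    have e1 : 1 - (a : ℝ) / N = (b + 1) / N := by rw [← hb']; field_simp
    have e2 : 1 - ((a + 1 : ℕ) : ℝ) / N = b / N := by rw [hbdef]; field_simp
    rw [e1, Real.log_div (by positivity) hN.ne'] at h1 h2
    rw [e2, Real.log_div hb.ne' hN.ne', Finset.sum_range_succ]
    rw [hb'] at h2 ⊢
    have hl : Real.log (b + 1) - Real.log b = Real.log ((b + 1) / b) := by
      rw [Real.log_div (by positivity) hb.ne']
    have l1 := Real.one_sub_inv_le_log_of_pos (show 0 < (b + 1) / b by positivity)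
    have l2 := Real.log_le_sub_one_of_pos (show 0 < (b + 1) / b by positivity)
    have e3 : 1 - ((b + 1) / b)⁻¹ = 1 / (b + 1) := by field_simp; ring
    have e4 : (b + 1) / b - 1 = 1 / b := by field_simp; ring
    constructor <;> linarith

/-- Telescoping of 1/m - 1/(m + 1) ≤ 1/m² ≤ 1/(m - 1) - 1/m. -/
lemma sum_inv_sq_bounds (N a : ℕ) (h : a < N) :
    1 / ((N : ℝ) - a + 1) - 1 / (N + 1) ≤ ∑ i ∈ Finset.range a, (1 : ℝ) / ((N : ℝ) - i) ^ 2 ∧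
    ∑ i ∈ Finset.range a, (1 : ℝ) / ((N : ℝ) - i) ^ 2 ≤ 1 / ((N : ℝ) - a) - 1 / N := by
  induction a with
  | zero => simp
  | succ a ih =>
    obtain ⟨h1, h2⟩ := ih (by omega)
    have hb : (0 : ℝ) < N - (a + 1 : ℕ) := by
      rw [sub_pos]; exact_mod_cast h
    set b : ℝ := N - (a + 1 : ℕ) with hbdef
    have hb' : (N : ℝ) - a = b + 1 := by rw [hbdef]; push_cast; ring
    rw [Finset.sum_range_succ]
    rw [hb'] at h1 h2 ⊢
    have e1 : 1 / (b + 1) - 1 / (b + 1 + 1) ≤ 1 / (b + 1) ^ 2 := by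
      rw [div_sub_div _ _ (by positivity) (by positivity), div_le_div_iff₀ (by positivity)
        (by positivity)]
      nlinarith
    have e2 : 1 / (b + 1) ^ 2 ≤ 1 / b - 1 / (b + 1) := by
      rw [div_sub_div _ _ (by positivity) (by positivity), div_le_div_iff₀ (by positivity)
        (by positivity)]
      nlinarith
    constructor <;> linarith

lemma norm_log_one_add_sub_le {x : ℂ} (hx : ‖x‖ ≤ 1 / 2) :
    ‖Complex.log (1 + x) - (x - x ^ 2 / 2)‖ ≤ ‖x‖ ^ 3 := by
  have h := Complex.norm_log_sub_logTaylor_le 2 (z := x) (by linarith)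
  have hT : Complex.logTaylor 3 x = x - x ^ 2 / 2 := by
    simp [Complex.logTaylor_succ, Complex.logTaylor_zero]
    ring
  rw [hT] at h
  refine h.trans ?_
  have h1 : (1 - ‖x‖)⁻¹ ≤ 2 := by
    rw [inv_le_comm₀ (by linarith) (by norm_num)]; linarith
  have h2 : 0 ≤ ‖x‖ ^ 3 := by positivity
  norm_num
  nlinarith

/-- Second order expansion of the logarithm of a product over a section of the integers. -/
lemma exists_prod_one_add_div_eq_exp (N a : ℕ) (h : a < N) {v : ℂ}
    (hv : ‖v‖ ≤ ((N : ℝ) - a) / 2) :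
    ∃ E : ℂ, ∏ i ∈ Finset.range a, (1 + v / ((N : ℂ) - i)) = Complex.exp E ∧
      ‖E - (v * (∑ i ∈ Finset.range a, (1 : ℝ) / ((N : ℝ) - i) : ℝ)
        - v ^ 2 / 2 * (∑ i ∈ Finset.range a, (1 : ℝ) / ((N : ℝ) - i) ^ 2 : ℝ))‖
      ≤ ‖v‖ ^ 3 / ((N : ℝ) - a) * ∑ i ∈ Finset.range a, (1 : ℝ) / ((N : ℝ) - i) ^ 2 := by
  have hb : (0 : ℝ) < N - a := by rw [sub_pos]; exact_mod_cast h
  have hl : ∀ i ∈ Finset.range a, (N : ℝ) - a ≤ N - i := fun i hi => by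
    have : (i : ℝ) ≤ a := by exact_mod_cast (Finset.mem_range.1 hi).le
    linarith
  have hnorm : ∀ i ∈ Finset.range a, ‖v / ((N : ℂ) - i)‖ = ‖v‖ / ((N : ℝ) - i) := fun i hi => by
    have h1 : (N : ℂ) - i = ((N - i : ℝ) : ℂ) := by push_cast; ring
    rw [norm_div, h1, Complex.norm_real, Real.norm_of_nonneg (hb.le.trans (hl i hi))]
  have hhalf : ∀ i ∈ Finset.range a, ‖v / ((N : ℂ) - i)‖ ≤ 1 / 2 := fun i hi => by
    rw [hnorm i hi, div_le_iff₀ (hb.trans_le (hl i hi))]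
    linarith [hl i hi]
  refine ⟨∑ i ∈ Finset.range a, Complex.log (1 + v / ((N : ℂ) - i)), ?_, ?_⟩
  · rw [Complex.exp_sum]
    refine Finset.prod_congr rfl fun i hi => (Complex.exp_log fun h0 => ?_).symm
    have h1 : v / ((N : ℂ) - i) = -1 := by linear_combination h0
    have h2 := hhalf i hi
    rw [h1] at h2
    norm_num at h2
  · have e : v * (∑ i ∈ Finset.range a, (1 : ℝ) / ((N : ℝ) - i) : ℝ)
        - v ^ 2 / 2 * (∑ i ∈ Finset.range a, (1 : ℝ) / ((N : ℝ) - i) ^ 2 : ℝ)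
        = ∑ i ∈ Finset.range a, (v / ((N : ℂ) - i) - (v / ((N : ℂ) - i)) ^ 2 / 2) := by
      push_cast
      rw [Finset.mul_sum, Finset.mul_sum, ← Finset.sum_sub_distrib]
      refine Finset.sum_congr rfl fun i _ => ?_
      simp only [div_eq_mul_inv, mul_pow, inv_pow, one_mul]
      ring
    rw [e, ← Finset.sum_sub_distrib, Finset.mul_sum]
    refine (norm_sum_le _ _).trans (Finset.sum_le_sum fun i hi => ?_)
    refine (norm_log_one_add_sub_le (hhalf i hi)).trans ?_
    rw [hnorm i hi]
    have hli := hb.trans_le (hl i hi)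
    calc (‖v‖ / ((N : ℝ) - i)) ^ 3 = ‖v‖ ^ 3 / ((N : ℝ) - i) * (1 / ((N : ℝ) - i) ^ 2) := by
          field_simp
      _ ≤ _ := mul_le_mul_of_nonneg_right
          (div_le_div_of_nonneg_left (by positivity) hb (hl i hi)) (by positivity)

/-- The deviation of the logarithm of `pairProd`, recentred, from its Gaussian limit form. -/
lemma exists_pairProd_mul_exp_eq_exp (N a : ℕ) (h : a < N) {θ T η D : ℝ}
    (hθ : |θ| ≤ 1) (hT : T = N ^ 2 * |θ|) (hη : η = 2 * |θ| + 1 / N)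
    (hD : D = 1 / ((N : ℝ) - a) - 1 / N) (hsmall : T * (1 + η) ≤ ((N : ℝ) - a) / 2) :
    ∃ E : ℂ, pairProd N (Complex.exp (θ * Complex.I))⁻¹ a *
        Complex.exp (-(θ * Complex.I * (N ^ 2 * Real.log (1 - a / N)))) = Complex.exp E ∧
      ‖E - ((T ^ 2 * (∑ i ∈ Finset.range a, (1 : ℝ) / ((N : ℝ) - i) ^ 2) / 2 : ℝ) : ℂ)‖
      ≤ T * D + T * η * (N * D) + T ^ 2 * D * (η + η ^ 2 / 2)
        + T ^ 2 * D * (1 + η) ^ 3 * (T / ((N : ℝ) - a)) := by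
  have hN : (1 : ℝ) ≤ N := by exact_mod_cast (by omega : 1 ≤ N)
  have hb : (0 : ℝ) < N - a := by rw [sub_pos]; exact_mod_cast h
  have hT0 : 0 ≤ T := by rw [hT]; positivity
  have hη0 : 0 ≤ η := by rw [hη]; positivity
  set z : ℂ := Complex.exp (-(θ * Complex.I)) - 1 with hz
  set v : ℂ := N * z * (N * (z + 1) + 1) with hv
  have hz1 : ‖z‖ ≤ |θ| := by
    have := Real.norm_exp_I_mul_ofReal_sub_one_le (x := -θ)
    rw [norm_neg, Real.norm_eq_abs] at this
    convert this using 3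
    push_cast; ring_nf
  have hz2 : ‖z + θ * Complex.I‖ ≤ |θ| ^ 2 := by
    have hnorm : ‖-(θ * Complex.I : ℂ)‖ = |θ| := by simp
    have := Complex.norm_exp_sub_one_sub_id_le (x := -(θ * Complex.I)) (by rw [hnorm]; exact hθ)
    rw [hnorm] at this
    convert this using 2
    rw [hz]; ring
  -- The deviation of `v` from its leading term -iθN².
  set e : ℂ := v + θ * Complex.I * N ^ 2 with he
  have hen : ‖e‖ ≤ T * η := by
    have e1 : e = N ^ 2 * (z + θ * Complex.I) + N ^ 2 * z ^ 2 + N * z := by rw [he, hv]; ring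
    have hNn : ‖(N : ℂ)‖ = N := by simp
    calc ‖e‖ ≤ ‖(N : ℂ) ^ 2 * (z + θ * Complex.I)‖ + ‖(N : ℂ) ^ 2 * z ^ 2‖ + ‖(N : ℂ) * z‖ := by
          rw [e1]; exact norm_add₃_le
      _ = N ^ 2 * ‖z + θ * Complex.I‖ + N ^ 2 * ‖z‖ ^ 2 + N * ‖z‖ := by
          simp only [norm_mul, norm_pow, hNn]
      _ ≤ N ^ 2 * |θ| ^ 2 + N ^ 2 * |θ| ^ 2 + N * |θ| := by gcongr
      _ = T * η := by rw [hT, hη]; field_simp; ring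
  have hve : v = e - θ * Complex.I * N ^ 2 := by rw [he]; ring
  have hTn : ‖θ * Complex.I * (N : ℂ) ^ 2‖ = T := by
    rw [hT]; simp [mul_comm]
  have hvn : ‖v‖ ≤ T * (1 + η) := by
    calc ‖v‖ ≤ ‖e‖ + ‖θ * Complex.I * (N : ℂ) ^ 2‖ := by rw [hve]; exact norm_sub_le _ _
      _ ≤ T * η + T := by rw [hTn]; gcongr
      _ = _ := by ring
  obtain ⟨E, hE, hEn⟩ := exists_prod_one_add_div_eq_exp N a h (hvn.trans hsmall)
  obtain ⟨hH1, hH1'⟩ := sum_inv_sub_log_bounds N a h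
  have hH2 := (sum_inv_sq_bounds N a h).2
  have hH1p : 0 ≤ ∑ i ∈ Finset.range a, (1 : ℝ) / ((N : ℝ) - i) := by
    refine Finset.sum_nonneg fun i hi => ?_
    have : (i : ℝ) ≤ a := by exact_mod_cast (Finset.mem_range.1 hi).le
    exact div_nonneg zero_le_one (by linarith)
  have hH2p : 0 ≤ ∑ i ∈ Finset.range a, (1 : ℝ) / ((N : ℝ) - i) ^ 2 :=
    Finset.sum_nonneg fun i hi => by positivity
  set H1 : ℝ := ∑ i ∈ Finset.range a, (1 : ℝ) / ((N : ℝ) - i)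
  set H2 : ℝ := ∑ i ∈ Finset.range a, (1 : ℝ) / ((N : ℝ) - i) ^ 2
  set L : ℝ := -Real.log (1 - a / N) with hL
  rw [← hD] at hH1' hH2
  have hD0 : 0 ≤ D := hH2p.trans hH2
  -- From 1 - q⁻¹ ≤ log q with q = 1 - a/N, as N · D = a/(N - a) = q⁻¹ - 1.
  have hLD : L ≤ N * D := by
    have hq : 0 < 1 - (a : ℝ) / N := by
      rw [sub_pos, div_lt_one (by linarith)]; linarith
    have h1 := Real.one_sub_inv_le_log_of_pos hq
    have h2 : N * D = (1 - (a : ℝ) / N)⁻¹ - 1 := by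
      have h3 : 1 - (a : ℝ) / N = (N - a) / N := by field_simp
      rw [hD, h3, inv_div]; field_simp
    rw [h2]; linarith
  refine ⟨E + θ * Complex.I * N ^ 2 * L, ?_, ?_⟩
  · rw [Complex.exp_add, ← hE, pairProd, ← Complex.exp_neg]
    congr 1
    · refine Finset.prod_congr rfl fun i _ => ?_
      rw [hv, hz]; ring
    · rw [hL]; push_cast; ring_nf
  · have hI : Complex.I ^ 2 = -1 := Complex.I_sq
    have hT2 : (T : ℂ) ^ 2 = (N : ℂ) ^ 4 * (θ : ℂ) ^ 2 := by
      have : T ^ 2 = (N : ℝ) ^ 4 * θ ^ 2 := by rw [hT, mul_pow, sq_abs]; ring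
      exact_mod_cast this
    -- Four errors: the cubic remainder, harmonic sum against logarithm, and the effect of `e` on
    -- the linear and on the quadratic term. The main term is -(iθN²)²/2 · H2 = T²H2/2.
    have split : E + θ * Complex.I * N ^ 2 * L - ((T ^ 2 * H2 / 2 : ℝ) : ℂ)
        = (E - (v * H1 - v ^ 2 / 2 * H2)) + θ * Complex.I * N ^ 2 * (L - H1 : ℝ) + e * H1
          + (θ * Complex.I * N ^ 2 * e - e ^ 2 / 2) * H2 := by
      rw [hve]
      push_cast
      rw [hT2]
      linear_combination (-(θ : ℂ) ^ 2 * (N : ℂ) ^ 4 * H2 / 2) * hI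
    rw [split]
    have b1 : ‖E - (v * H1 - v ^ 2 / 2 * H2)‖
        ≤ T ^ 2 * D * (1 + η) ^ 3 * (T / ((N : ℝ) - a)) := by
      calc _ ≤ ‖v‖ ^ 3 / ((N : ℝ) - a) * H2 := hEn
        _ ≤ (T * (1 + η)) ^ 3 / ((N : ℝ) - a) * D := by gcongr
        _ = _ := by ring
    have b2 : ‖θ * Complex.I * (N : ℂ) ^ 2 * (L - H1 : ℝ)‖ ≤ T * D := by
      rw [norm_mul, hTn, Complex.norm_real, Real.norm_of_nonneg (by linarith)]
      gcongr; linarith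
    have b3 : ‖e * H1‖ ≤ T * η * (N * D) := by
      rw [norm_mul, Complex.norm_real, Real.norm_of_nonneg hH1p]
      gcongr; linarith
    have b4 : ‖(θ * Complex.I * N ^ 2 * e - e ^ 2 / 2) * H2‖
        ≤ T ^ 2 * D * (η + η ^ 2 / 2) := by
      rw [norm_mul, Complex.norm_real, Real.norm_of_nonneg hH2p]
      calc _ ≤ (T * (T * η) + (T * η) ^ 2 / 2) * D := by
            gcongr
            refine (norm_sub_le _ _).trans ?_
            rw [norm_mul, hTn, norm_div, norm_pow, RCLike.norm_ofNat]
            gcongr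
        _ = _ := by ring
    refine (norm_add₄_le).trans ?_
    linarith

/-! ### Passage to the limit. -/

/-- The reciprocal characteristic function of the recentred waiting time converges. -/
lemma tendsto_pairProd_mul_exp {a : ℕ → ℕ} (ha : Tendsto a atTop atTop)
    (hb : Tendsto (fun n : ℕ => (n : ℝ) - a n) atTop atTop) {θ : ℕ → ℝ} {t : ℝ}
    (hθ : Tendsto (fun n : ℕ => θ n ^ 2 * ((n : ℝ) ^ 3 * a n / ((n : ℝ) - a n))) atTop
      (𝓝 (t ^ 2))) :
    Tendsto (fun n : ℕ => pairProd n (Complex.exp (θ n * Complex.I))⁻¹ (a n) *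
      Complex.exp (-(θ n * Complex.I * ((n : ℂ) ^ 2 * Real.log (1 - a n / n))))) atTop
      (𝓝 (Complex.exp (t ^ 2 / 2))) := by
  have haR : Tendsto (fun n => (a n : ℝ)) atTop atTop := tendsto_natCast_atTop_atTop.comp ha
  have hnR : Tendsto (fun n : ℕ => (n : ℝ)) atTop atTop := tendsto_natCast_atTop_atTop
  have hpos : ∀ᶠ n : ℕ in atTop, 0 < (a n : ℝ) ∧ 0 < (n : ℝ) - a n ∧ 0 < (n : ℝ) := by
    filter_upwards [haR.eventually_gt_atTop 0, hb.eventually_gt_atTop 0,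
      hnR.eventually_gt_atTop 0] with n h1 h2 h3 using ⟨h1, h2, h3⟩
  set T : ℕ → ℝ := fun n => n ^ 2 * |θ n| with hT
  set η : ℕ → ℝ := fun n => 2 * |θ n| + 1 / n with hη
  set D : ℕ → ℝ := fun n => 1 / ((n : ℝ) - a n) - 1 / n with hD
  set H2 : ℕ → ℝ := fun n => ∑ i ∈ Finset.range (a n), (1 : ℝ) / ((n : ℝ) - i) ^ 2 with hH2
  have hT0 : ∀ n, 0 ≤ T n := fun n => by positivity
  have hinvb : Tendsto (fun n : ℕ => 1 / ((n : ℝ) - a n)) atTop (𝓝 0) :=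
    tendsto_const_nhds.div_atTop hb
  have hinva : Tendsto (fun n : ℕ => 1 / (a n : ℝ)) atTop (𝓝 0) :=
    tendsto_const_nhds.div_atTop haR
  have hinvn : Tendsto (fun n : ℕ => 1 / (n : ℝ)) atTop (𝓝 0) :=
    tendsto_const_nhds.div_atTop hnR
  have hD0 : Tendsto D atTop (𝓝 0) := by
    have := hinvb.sub hinvn
    rwa [sub_zero] at this
  have hκ : Tendsto (fun n => T n ^ 2 * D n) atTop (𝓝 (t ^ 2)) := by
    refine hθ.congr' ?_
    filter_upwards [hpos] with n ⟨h1, h2, h3⟩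
    simp only [hT, hD]
    rw [mul_pow, sq_abs]
    field_simp
    ring
  have sqrt_lim : ∀ f : ℕ → ℝ, (∀ᶠ n in atTop, 0 ≤ f n) →
      Tendsto (fun n => f n ^ 2) atTop (𝓝 0) → Tendsto f atTop (𝓝 0) := by
    intro f hf h
    have := (Real.continuous_sqrt.tendsto 0).comp h
    rw [Real.sqrt_zero] at this
    refine this.congr' ?_
    filter_upwards [hf] with n hn
    simp [Real.sqrt_sq hn]
  have hDpos : ∀ᶠ n in atTop, 0 ≤ D n := by
    filter_upwards [hpos] with n ⟨h1, h2, h3⟩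
    simp only [hD]
    rw [sub_nonneg]
    exact one_div_le_one_div_of_le h2 (by linarith)
  have hTD : Tendsto (fun n => T n * D n) atTop (𝓝 0) := by
    refine sqrt_lim _ ?_ ?_
    · filter_upwards [hDpos] with n hn using mul_nonneg (hT0 n) hn
    · have := hκ.mul hD0
      rw [mul_zero] at this
      exact this.congr fun n => by ring
  -- With b = n - a, the square is T²D · (1/a + 1/b), because 1/b² = D · n/(ab) and n = a + b.
  have hTb : Tendsto (fun n : ℕ => T n / ((n : ℝ) - a n)) atTop (𝓝 0) := by
    refine sqrt_lim _ ?_ ?_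
    · filter_upwards [hpos] with n hn using div_nonneg (hT0 n) hn.2.1.le
    · have := hκ.mul (hinva.add hinvb)
      rw [add_zero, mul_zero] at this
      refine this.congr' ?_
      filter_upwards [hpos] with n ⟨h1, h2, h3⟩
      simp only [hD]
      field_simp
      ring
  have hθ0 : Tendsto (fun n => |θ n|) atTop (𝓝 0) := by
    refine squeeze_zero' (Eventually.of_forall fun n => abs_nonneg _) ?_ hTb
    filter_upwards [hpos] with n ⟨h1, h2, h3⟩
    rw [le_div_iff₀ h2]
    have h4 : (1 : ℝ) ≤ n := by
      exact_mod_cast Nat.one_le_iff_ne_zero.2 (by rintro rfl; simp at h3)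
    have h5 : (n : ℝ) - a n ≤ n ^ 2 := by nlinarith
    exact (mul_le_mul_of_nonneg_left h5 (abs_nonneg _)).trans_eq (mul_comm _ _)
  have hη0 : Tendsto η atTop (𝓝 0) := by
    have := (hθ0.const_mul 2).add hinvn
    rwa [mul_zero, add_zero] at this
  have hratio : Tendsto (fun n => T n ^ 2 * H2 n) atTop (𝓝 (t ^ 2)) := by
    -- The lower bound 1/(b + 1) - 1/(n + 1) equals D · n/(n + 1) · b/(b + 1), where b = n - a.
    have hlow : Tendsto (fun n : ℕ => T n ^ 2 * D n *
        (1 / (1 + 1 / (n : ℝ)) * (1 / (1 + 1 / ((n : ℝ) - a n))))) atTop (𝓝 (t ^ 2)) := by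
      have h1 : Tendsto (fun n : ℕ => 1 / (1 + 1 / (n : ℝ))) atTop (𝓝 (1 / (1 + 0))) :=
        tendsto_const_nhds.div (hinvn.const_add 1) (by norm_num)
      have h2 : Tendsto (fun n : ℕ => 1 / (1 + 1 / ((n : ℝ) - a n))) atTop (𝓝 (1 / (1 + 0))) :=
        tendsto_const_nhds.div (hinvb.const_add 1) (by norm_num)
      simpa using hκ.mul (h1.mul h2)
    refine tendsto_of_tendsto_of_tendsto_of_le_of_le' hlow hκ ?_ ?_
    · filter_upwards [hpos] with n ⟨h1, h2, h3⟩
      have := (sum_inv_sq_bounds n (a n) (by exact_mod_cast sub_pos.1 h2)).1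
      rw [mul_assoc]
      refine mul_le_mul_of_nonneg_left (le_trans (le_of_eq ?_) this) (sq_nonneg _)
      simp only [hD]
      have h4 : (n : ℝ) - a n + 1 ≠ 0 := by positivity
      field_simp
      ring
    · filter_upwards [hpos] with n ⟨h1, h2, h3⟩
      exact mul_le_mul_of_nonneg_left
        (sum_inv_sq_bounds n (a n) (by exact_mod_cast sub_pos.1 h2)).2 (sq_nonneg _)
  have herr : Tendsto (fun n : ℕ => T n * D n + T n * η n * (n * D n)
      + T n ^ 2 * D n * (η n + η n ^ 2 / 2)
      + T n ^ 2 * D n * (1 + η n) ^ 3 * (T n / ((n : ℝ) - a n))) atTop (𝓝 0) := by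
    -- Inserting η = 2|θ| + 1/n and |θ| = T/n² turns this term into 2T²D/n + TD.
    have h2 : Tendsto (fun n : ℕ => T n * η n * (n * D n)) atTop (𝓝 0) := by
      have := ((hκ.mul hinvn).const_mul 2).add hTD
      rw [mul_zero, mul_zero, add_zero] at this
      refine this.congr' ?_
      filter_upwards [hpos] with n ⟨_, _, h3⟩
      simp only [hη, hT]
      field_simp
    have h3 : Tendsto (fun n : ℕ => T n ^ 2 * D n * (η n + η n ^ 2 / 2)) atTop (𝓝 0) := by
      simpa using hκ.mul (hη0.add ((hη0.pow 2).div_const 2))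
    have h4 := (hκ.mul ((hη0.const_add 1).pow 3)).mul hTb
    rw [mul_zero] at h4
    simpa using ((hTD.add h2).add h3).add h4
  have hsmall : ∀ᶠ n : ℕ in atTop, T n * (1 + η n) ≤ ((n : ℝ) - a n) / 2 := by
    have : Tendsto (fun n : ℕ => T n / ((n : ℝ) - a n) * (1 + η n)) atTop (𝓝 0) := by
      simpa using hTb.mul (hη0.const_add 1)
    filter_upwards [hpos, this.eventually_le_const (show (0 : ℝ) < 1 / 2 by norm_num)] with
      n ⟨_, h2, _⟩ h
    rw [div_mul_eq_mul_div, div_le_iff₀ h2] at h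
    linarith
  have hex : ∀ᶠ n : ℕ in atTop, ∃ E : ℂ,
      pairProd n (Complex.exp (θ n * Complex.I))⁻¹ (a n) *
        Complex.exp (-(θ n * Complex.I * ((n : ℂ) ^ 2 * Real.log (1 - a n / n))))
        = Complex.exp E ∧
      ‖E - ((T n ^ 2 * H2 n / 2 : ℝ) : ℂ)‖ ≤ T n * D n + T n * η n * (n * D n)
      + T n ^ 2 * D n * (η n + η n ^ 2 / 2)
      + T n ^ 2 * D n * (1 + η n) ^ 3 * (T n / ((n : ℝ) - a n)) := by
    filter_upwards [hpos, hsmall, hθ0.eventually_le_const zero_lt_one] with n ⟨_, h2, _⟩ h hθn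
    exact exists_pairProd_mul_exp_eq_exp n (a n) (by exact_mod_cast sub_pos.1 h2) hθn rfl rfl rfl h
  obtain ⟨E, hE⟩ := hex.choice
  have hElim : Tendsto E atTop (𝓝 ((t : ℂ) ^ 2 / 2)) := by
    have h1 : Tendsto (fun n => E n - ((T n ^ 2 * H2 n / 2 : ℝ) : ℂ)) atTop (𝓝 0) :=
      squeeze_zero_norm' (hE.mono fun n hn => hn.2) herr
    have h2 : Tendsto (fun n => ((T n ^ 2 * H2 n / 2 : ℝ) : ℂ)) atTop
        (𝓝 ((t ^ 2 / 2 : ℝ) : ℂ)) :=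
      (Complex.continuous_ofReal.tendsto _).comp (hratio.div_const 2)
    simpa using h1.add h2
  refine ((Complex.continuous_exp.tendsto _).comp hElim).congr' ?_
  filter_upwards [hE] with n hn using hn.1.symm

/-- Convergence of characteristic functions to that of the standard normal distribution implies
convergence of distribution functions. -/
lemma tendsto_measureReal_Iic_of_tendsto_charFun {μ : ℕ → Measure ℝ}
    [∀ n, IsProbabilityMeasure (μ n)]
    (h : ∀ t : ℝ, Tendsto (fun n => charFun (μ n) t) atTop (𝓝 (Complex.exp (-(t ^ 2 / 2)))))
    (x : ℝ) : Tendsto (fun n => (μ n).real (Set.Iic x)) atTop (𝓝 (stdNormalCDF x)) := by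
  let ν : ℕ → ProbabilityMeasure ℝ := fun n => ⟨μ n, inferInstance⟩
  let γ : ProbabilityMeasure ℝ := ⟨gaussianReal 0 1, inferInstance⟩
  have hlim : Tendsto ν atTop (𝓝 γ) := by
    refine ProbabilityMeasure.tendsto_of_tendsto_charFun fun t => ?_
    have : charFun (γ : Measure ℝ) t = Complex.exp (-(t ^ 2 / 2)) := by
      change charFun (gaussianReal 0 1) t = _
      rw [charFun_gaussianReal]
      simp
    rw [this]
    exact h t
  -- The Gaussian has no atoms, so every half-line is a continuity set of the limit.
  have hatom : NullSingletonClass (gaussianReal 0 1) := nullSingletonClass_gaussianReal one_ne_zero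
  have hfr : (γ : Measure ℝ) (frontier (Set.Iic x)) = 0 := by
    rw [frontier_Iic]
    exact hatom.measure_singleton x
  have := ProbabilityMeasure.tendsto_measure_of_null_frontier_of_tendsto' hlim hfr
  rw [stdNormalCDF, cdf_eq_real]
  exact (ENNReal.tendsto_toReal (measure_ne_top _ _)).comp this

lemma IsUniformSampling.charFun_eq {Ω : Type*} [MeasurableSpace Ω] {P : Measure Ω}
    [IsProbabilityMeasure P] {n : ℕ} {Z : ℕ → Ω → ℕ} (hZ : IsUniformSampling n P Z) {a : ℕ}
    (ha : 1 ≤ a) (han : a ≤ n) (c σ t : ℝ) :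
    charFun (P.map fun ω => ((waitingTime n a fun i => Z i ω : ℕ) + c) / σ) t =
      (pairProd n (Complex.exp ((t / σ : ℝ) * Complex.I))⁻¹ a *
        Complex.exp (-((t / σ : ℝ) * Complex.I * c)))⁻¹ := by
  have hS : Measurable fun ω => ((waitingTime n a fun i => Z i ω : ℕ) : ℝ) :=
    measurable_from_top.comp (hZ.measurable_waitingTime a)
  have hX : Measurable fun ω => ((waitingTime n a fun i => Z i ω : ℕ) + c) / σ :=
    (hS.add_const c).div_const σ
  have key := hZ.integral_pow_waitingTime ha han
    (Complex.norm_exp_ofReal_mul_I (t / σ))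
  rw [charFun_apply_real, integral_map hX.aemeasurable (by fun_prop)]
  have : ∀ ω, Complex.exp (t * (((waitingTime n a fun i => Z i ω : ℕ) + c) / σ : ℝ) * Complex.I)
      = Complex.exp ((t / σ : ℝ) * Complex.I) ^ (waitingTime n a fun i => Z i ω) *
        Complex.exp ((t / σ : ℝ) * Complex.I * c) := by
    intro ω
    rw [← Complex.exp_nat_mul, ← Complex.exp_add]
    congr 1
    push_cast
    ring
  simp_rw [this]
  rw [integral_mul_const, mul_inv, Complex.exp_neg (_ * _ * _), inv_inv,
    eq_inv_of_mul_eq_one_left key]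

/-- Asymptotic normality of the waiting time, for any equivalent of the standard deviation. -/
lemma tendsto_waitingTime_cdf
    {Ω : ℕ → Type*} [∀ n, MeasurableSpace (Ω n)]
    (P : ∀ n, Measure (Ω n)) [∀ n, IsProbabilityMeasure (P n)]
    (Z : ∀ n, ℕ → Ω n → ℕ) (hZ : ∀ n, 1 ≤ n → IsUniformSampling n (P n) (Z n))
    (a : ℕ → ℕ) (ha : ∀ n, 1 ≤ n → 1 ≤ a n ∧ a n ≤ n)
    (ha' : Tendsto a atTop atTop) (hb : Tendsto (fun n : ℕ => (n : ℝ) - a n) atTop atTop)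
    (σ : ℕ → ℝ)
    (hσ : Tendsto (fun n : ℕ => (n : ℝ) ^ 3 * a n / ((n : ℝ) - a n) / σ n ^ 2) atTop (𝓝 1))
    (x : ℝ) :
    Tendsto (fun n : ℕ => (P n).real {ω |
      ((waitingTime n (a n) (fun i => Z n i ω) : ℝ)
        + (n : ℝ) ^ 2 * Real.log (1 - (a n : ℝ) / n)) / σ n ≤ x}) atTop
      (𝓝 (stdNormalCDF x)) := by
  -- The shift discards n = 0, where neither the sampling nor the bounds on `a` are assumed.
  rw [← tendsto_add_atTop_iff_nat 1]
  let X : ∀ n, Ω n → ℝ := fun n ω => ((waitingTime n (a n) (fun i => Z n i ω) : ℝ)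
    + (n : ℝ) ^ 2 * Real.log (1 - (a n : ℝ) / n)) / σ n
  have hX : ∀ n, 1 ≤ n → Measurable (X n) := fun n hn =>
    ((measurable_from_top.comp ((hZ n hn).measurable_waitingTime (a n))).add_const _).div_const _
  have hprob : ∀ n, IsProbabilityMeasure ((P (n + 1)).map (X (n + 1))) := fun n =>
    Measure.isProbabilityMeasure_map (hX _ (by omega)).aemeasurable
  have hlim := tendsto_measureReal_Iic_of_tendsto_charFun
    (μ := fun n => (P (n + 1)).map (X (n + 1))) (fun t => ?_) x
  · refine hlim.congr fun n => ?_
    rw [map_measureReal_apply (hX _ (by omega)) measurableSet_Iic]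
    rfl
  · have hθ : Tendsto (fun n : ℕ => (t / σ n) ^ 2 * ((n : ℝ) ^ 3 * a n / ((n : ℝ) - a n))) atTop
        (𝓝 (t ^ 2)) := by
      have := hσ.const_mul (t ^ 2)
      rw [mul_one] at this
      exact this.congr fun n => by ring
    have hchar := ((tendsto_pairProd_mul_exp ha' hb hθ).inv₀ (Complex.exp_ne_zero _)).comp
      (tendsto_add_atTop_nat 1)
    rw [← Complex.exp_neg] at hchar
    refine hchar.congr fun n => ?_
    have := (hZ (n + 1) (by omega)).charFun_eq (ha (n + 1) (by omega)).1 (ha (n + 1) (by omega)).2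
      (((n + 1 : ℕ) : ℝ) ^ 2 * Real.log (1 - (a (n + 1) : ℝ) / (n + 1 : ℕ))) (σ (n + 1)) t
    simp only [X, this, Function.comp]
    push_cast
    rfl

/-! ### The three regimes. -/

theorem theorem3p2
    {Ω : ℕ → Type*} [∀ n, MeasurableSpace (Ω n)]
    (P : ∀ n, Measure (Ω n)) [∀ n, IsProbabilityMeasure (P n)]
    (Z : ∀ n, ℕ → Ω n → ℕ) (hZ : ∀ n, 1 ≤ n → IsUniformSampling n (P n) (Z n))
    (a : ℕ → ℕ) (ha : ∀ n, 1 ≤ n → 1 ≤ a n ∧ a n ≤ n) :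
    -- the waiting time is almost surely finite
    (∀ n, 1 ≤ n → ∀ᵐ ω ∂(P n), ∃ k, a n ≤ (sampledPairs n (fun i => Z n i ω) k).card) ∧
    -- (a)
    (Tendsto a atTop atTop → Tendsto (fun n : ℕ => (a n : ℝ) / n) atTop (𝓝 0) →
      ∀ x : ℝ, Tendsto (fun n : ℕ => (P n).real {ω |
          ((waitingTime n (a n) (fun i => Z n i ω) : ℝ)
            + (n : ℝ) ^ 2 * Real.log (1 - (a n : ℝ) / n))
            / ((n : ℝ) * √(a n : ℝ)) ≤ x})
        atTop (𝓝 (stdNormalCDF x))) ∧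
    -- (b)
    (∀ lam : ℝ, 0 < lam → lam < 1 → Tendsto (fun n : ℕ => (a n : ℝ) / n) atTop (𝓝 lam) →
      ∀ x : ℝ, Tendsto (fun n : ℕ => (P n).real {ω |
          ((waitingTime n (a n) (fun i => Z n i ω) : ℝ)
            + (n : ℝ) ^ 2 * Real.log (1 - (a n : ℝ) / n))
            / (√(lam / (1 - lam)) * (n : ℝ) ^ (3 / 2 : ℝ)) ≤ x})
        atTop (𝓝 (stdNormalCDF x))) ∧
    -- (c)
    (Tendsto (fun n : ℕ => (a n : ℝ) / n) atTop (𝓝 1) →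
      Tendsto (fun n : ℕ => (n : ℝ) - (a n : ℝ)) atTop atTop →
      ∀ x : ℝ, Tendsto (fun n : ℕ => (P n).real {ω |
          ((waitingTime n (a n) (fun i => Z n i ω) : ℝ)
            + (n : ℝ) ^ 2 * Real.log (1 - (a n : ℝ) / n))
            / ((n : ℝ) ^ 2 / √((n : ℝ) - (a n : ℝ))) ≤ x})
        atTop (𝓝 (stdNormalCDF x))) := by
  have hnR : Tendsto (fun n : ℕ => (n : ℝ)) atTop atTop := tendsto_natCast_atTop_atTop
  have atop : ∀ lam : ℝ, 0 < lam → Tendsto (fun n : ℕ => (a n : ℝ) / n) atTop (𝓝 lam) →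
      Tendsto a atTop atTop := by
    intro lam hlam h
    rw [← tendsto_natCast_atTop_iff (R := ℝ)]
    refine (h.pos_mul_atTop hlam hnR).congr' ?_
    filter_upwards [hnR.eventually_gt_atTop 0] with n hn
    field_simp
  have btop : ∀ lam : ℝ, lam < 1 → Tendsto (fun n : ℕ => (a n : ℝ) / n) atTop (𝓝 lam) →
      Tendsto (fun n : ℕ => (n : ℝ) - a n) atTop atTop := by
    intro lam hlam h
    refine ((h.const_sub 1).pos_mul_atTop (sub_pos.2 hlam) hnR).congr' ?_
    filter_upwards [hnR.eventually_gt_atTop 0] with n hn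
    field_simp
  refine ⟨fun n hn => (hZ n hn).ae_exists_le_card (ha n hn).1 (ha n hn).2, ?_, ?_, ?_⟩
  · intro ha' hlim x
    have hb := btop 0 one_pos hlim
    refine tendsto_waitingTime_cdf P Z hZ a ha ha' hb _ ?_ x
    -- Here the variance ratio is n/(n - a).
    have h1 : Tendsto (fun n : ℕ => (1 - (a n : ℝ) / n)⁻¹) atTop (𝓝 1) := by
      simpa using (hlim.const_sub 1).inv₀ (by norm_num)
    refine h1.congr' ?_
    filter_upwards [hb.eventually_gt_atTop 0, hnR.eventually_gt_atTop 0,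
      eventually_ge_atTop 1] with n hbn hn hn1
    have han : (0 : ℝ) < a n := by exact_mod_cast (ha n hn1).1
    have e : 1 - (a n : ℝ) / n = (n - a n) / n := by field_simp
    rw [mul_pow, Real.sq_sqrt han.le, e]
    field_simp
  · intro lam h0 h1 hlim x
    have hb := btop lam h1 hlim
    refine tendsto_waitingTime_cdf P Z hZ a ha (atop lam h0 hlim) hb _ ?_ x
    have h1' : 0 < 1 - lam := sub_pos.2 h1
    -- Here the variance ratio is a/(n - a) divided by λ/(1 - λ).
    have h2 : Tendsto (fun n : ℕ => (a n : ℝ) / n / (1 - (a n : ℝ) / n) / (lam / (1 - lam))) atTop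
        (𝓝 (lam / (1 - lam) / (lam / (1 - lam)))) :=
      (hlim.div (hlim.const_sub 1) h1'.ne').div_const _
    rw [div_self (by positivity)] at h2
    refine h2.congr' ?_
    filter_upwards [hb.eventually_gt_atTop 0, hnR.eventually_gt_atTop 0] with n hbn hn
    have e : 1 - (a n : ℝ) / n = (n - a n) / n := by field_simp
    have e2 : ((n : ℝ) ^ (3 / 2 : ℝ)) ^ 2 = (n : ℝ) ^ 3 := by
      rw [← Real.rpow_natCast, ← Real.rpow_mul hn.le, ← Real.rpow_natCast]
      norm_num
    rw [mul_pow, Real.sq_sqrt (by positivity), e, e2]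
    field_simp
  · intro hlim hb x
    refine tendsto_waitingTime_cdf P Z hZ a ha (atop 1 one_pos hlim) hb _ ?_ x
    -- Here the variance ratio is exactly a/n.
    refine hlim.congr' ?_
    filter_upwards [hb.eventually_gt_atTop 0, hnR.eventually_gt_atTop 0] with n hbn hn
    rw [div_pow, Real.sq_sqrt hbn.le]
    field_simp
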